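/- Let $\mathbb{R}_{\min}=\mathbb{R}\cup\{+\infty\}$ be the min-plus semiring, with addition $x\oplus y=\min(x,y)$ and multiplication $xy=x+y$ (zero $+\infty$, unit $0$). Let $\mathscr{C}$ be the ring of germs at $0^+$ of continuous functions $f:(0,\epsilon_0)\to\mathbb{C}$ such that $|f(\epsilon)|\le\epsilon^{-k}$ on $(0,\epsilon_0)$ for some constant $k>0$. For $f\in\mathscr{C}$, $a\in\mathbb{C}$ and $A\in\mathbb{R}_{\min}$, write $f(\epsilon)\simeq a\epsilon^A$ if either $A\in\mathbb{R}$ and $\epsilon^{-A}f(\epsilon)\to a$ as $\epsilon\to0^+$ (where $a=0$ is allowed), or $A=+\infty$ and $f=0$ near $0$; write $f(\epsilon)\sim a\epsilon^A$, and say that $f$ has first order asymptotics, if moreover $a\ne0$ whenever $A\in\mathbb{R}$. Let $A=(A_{ij})\in\mathbb{R}_{\min}^{n\times n}$ be irreducible, that is, the directed graph on $\{1,\dots,n\}$ with an arc $(i,j)$ whenever $A_{ij}\ne+\infty$ is strongly connected. Let $\Gamma=(\gamma_1\le\cdots\le\gamma_n)$ be the sequence of roots of its min-plus characteristic polynomial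 $$P=\operatorname{per}(\mathsf{Y}I\oplus A)=\bigoplus_{\sigma\in\mathfrak{S}_n}\bigotimes_{i=1}^n(\mathsf{Y}\delta_{i\sigma(i)}\oplus A_{i\sigma(i)}),$$ that is, the unique nondecreasing sequence in $\mathbb{R}_{\min}$ such that $P(y)=(y\oplus\gamma_1)\cdots(y\oplus\gamma_n)$ for all $y\in\mathbb{R}_{\min}$ (the leading coefficient of $P$ is the unit $0$). 1. Let $a=(a_{ij})\in\mathbb{C}^{n\times n}$ and let $\mathcal{A}\in\mathscr{C}^{n\times n}$ satisfy $(\mathcal{A}_\epsilon)_{ij}\simeq a_{ij}\epsilon^{A_{ij}}$ for all $i,j$. Assume that the eigenvalues $\mathcal{L}^1_\epsilon,\dots,\mathcal{L}^n_\epsilon$ of $\mathcal{A}_\epsilon$, counted with multiplicities, belong to $\mathscr{C}$ and have first order asymptotics $\mathcal{L}^i_\epsilon\sim\lambda_i\epsilon^{\Lambda_i}$, and let $\Lambda=(\Lambda_{1}\le\cdots\le\Lambda_{n})$ be the nondecreasing sequence of their exponents. Then $\Lambda$ is weakly (super) majorised by $\Gamma$, that is, $$\Lambda_1+\cdots+\Lambda_k\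 \ge\ \gamma_1+\cdots+\gamma_k\qquad\text{for all }k=1,\dots,n.$$ 2. For generic values of $a\in\mathbb{C}^{n\times n}$, $\Lambda=\Gamma$. That is, there is a nonzero polynomial $Q$ in $n^2$ variables with complex coefficients, depending only on $A$, such that for every $a\in\mathbb{C}^{n\times n}$ with $Q(a)\ne0$, every $\mathcal{A}$ as in 1 with these $a$ and $A$, whose eigenvalues belong to $\mathscr{C}$ and have first order asymptotics, satisfies $\Lambda=\Gamma$. -/

import Mathlib

open Filter Topology

namespace MinPlus

/-- The min-plus semiring: `ℝ ∪ {+∞}` with addition `min` and multiplication `+`.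
Its zero is `+∞`, its unit is the real number `0`, and its order is the usual order
of `ℝ ∪ {+∞}`. -/
abbrev Rmin : Type := Tropical (WithTop ℝ)

/-- The real number `r`, viewed as an element of the min-plus semiring. -/
def ofReal (r : ℝ) : Rmin := Tropical.trop (r : WithTop ℝ)

/-! ### Germs and first order asymptotics -/

/-- `f` represents an element of the ring `𝒞`: on some interval `(0, ε₀)`, it is continuous and
`|f ε| ≤ ε ^ (-k)` for some positive constant `k`. -/
def IsModerate (f : ℝ → ℂ) : Prop :=
  ∃ ε₀ : ℝ, 0 < ε₀ ∧ ContinuousOn f (Set.Ioo 0 ε₀) ∧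
    ∃ k : ℝ, 0 < k ∧ ∀ ε ∈ Set.Ioo (0 : ℝ) ε₀, ‖f ε‖ ≤ ε ^ (-k)

/-- `f(ε) ≃ a ε ^ A` as `ε → 0⁺`: either `A = +∞` and `f` vanishes near `0⁺`, or `A` is real and
`ε ^ (-A) f(ε) → a`, where `a` may be zero. -/
def WeakAsymp (f : ℝ → ℂ) (a : ℂ) (A : Rmin) : Prop :=
  (A = 0 ∧ ∀ᶠ ε in 𝓝[>] (0 : ℝ), f ε = 0) ∨
  ∃ r : ℝ, A = ofReal r ∧
    Tendsto (fun ε : ℝ => ((ε ^ (-r) : ℝ) : ℂ) * f ε) (𝓝[>] (0 : ℝ)) (𝓝 a)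

/-- First order asymptotics `f(ε) ∼ a ε ^ A` as `ε → 0⁺`: either `A = +∞` and `f` vanishes
near `0⁺`, or `A` is real, `a ≠ 0` and `ε ^ (-A) f(ε) → a`. -/
def FirstOrderAsymp (f : ℝ → ℂ) (a : ℂ) (A : Rmin) : Prop :=
  (A = 0 ∧ ∀ᶠ ε in 𝓝[>] (0 : ℝ), f ε = 0) ∨
  ∃ r : ℝ, A = ofReal r ∧ a ≠ 0 ∧
    Tendsto (fun ε : ℝ => ((ε ^ (-r) : ℝ) : ℂ) * f ε) (𝓝[>] (0 : ℝ)) (𝓝 a)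

/-- The matrix `𝒜` has entries in `𝒞` and `(𝒜_ε)_{ij} ≃ a_{ij} ε ^ A_{ij}`. -/
def HasEntryAsymp {n : ℕ} (𝒜 : ℝ → Matrix (Fin n) (Fin n) ℂ)
    (a : Matrix (Fin n) (Fin n) ℂ) (A : Matrix (Fin n) (Fin n) Rmin) : Prop :=
  ∀ i j, IsModerate (fun ε => 𝒜 ε i j) ∧ WeakAsymp (fun ε => 𝒜 ε i j) (a i j) (A i j)

/-- `𝓛 0 ε, …, 𝓛 (n-1) ε` are the eigenvalues of `𝒜_ε` counted with (algebraic) multiplicities,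
for all small `ε > 0`; they belong to `𝒞` and `𝓛 i ε ∼ l i ε ^ (L i)`. -/
def HasEigenvalueAsymp {n : ℕ} (𝒜 : ℝ → Matrix (Fin n) (Fin n) ℂ)
    (𝓛 : Fin n → ℝ → ℂ) (l : Fin n → ℂ) (L : Fin n → Rmin) : Prop :=
  (∀ᶠ ε in 𝓝[>] (0 : ℝ),
    (𝒜 ε).charpoly.roots = Finset.univ.val.map (fun i => 𝓛 i ε)) ∧
  ∀ i, IsModerate (𝓛 i) ∧ FirstOrderAsymp (𝓛 i) (l i) (L i)

/-! ### Irreducibility, weak majorisation, genericity -/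

/-- `A` is irreducible: the directed graph with an arc `(i, j)` whenever `A i j ≠ +∞` is
strongly connected. -/
def IsIrreducible {n : ℕ} (A : Matrix (Fin n) (Fin n) Rmin) : Prop :=
  ∀ i j, Relation.ReflTransGen (fun i j => A i j ≠ 0) i j

/-- The components of `u` in increasing order. -/
noncomputable def increasing {n : ℕ} (u : Fin n → Rmin) : Fin n → Rmin := u ∘ Tuple.sort u

/-- `u` is weakly (super) majorised by `v`: the sum (a product in `Rmin`) of the `k` smallest
components of `u` is at least that of `v`, for `k = 1, …, n`. -/
def WeaklyMajorised {n : ℕ} (u v : Fin n → Rmin) : Prop :=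
  ∀ k : Fin n, ∏ i ∈ Finset.Iic k, increasing v i ≤ ∏ i ∈ Finset.Iic k, increasing u i

/-- A property of complex `n × n` matrices holds generically: the matrices for which it fails
all lie on the zero set of some nonzero polynomial in the entries. -/
def HoldsGenerically {n : ℕ} (p : Matrix (Fin n) (Fin n) ℂ → Prop) : Prop :=
  ∃ Q : MvPolynomial (Fin n × Fin n) ℂ, Q ≠ 0 ∧
    ∀ a : Matrix (Fin n) (Fin n) ℂ, ¬ p a → MvPolynomial.eval (fun ij => a ij.1 ij.2) Q = 0

/-! ### Min-plus polynomials and their roots -/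

/-- The min-plus characteristic polynomial `per (Y I ⊕ A)`. -/
noncomputable def charpoly {n : ℕ} (A : Matrix (Fin n) (Fin n) Rmin) : Polynomial Rmin :=
  (Matrix.scalar (Fin n) (Polynomial.X : Polynomial Rmin) + A.map Polynomial.C).permanent

/-- `c` is the nondecreasing sequence of roots of the min-plus polynomial `P` of degree `n`:
`P(y) = Pₙ (y ⊕ c₁) ⋯ (y ⊕ cₙ)` for all `y`, as polynomial functions. -/
def IsRootSeq {n : ℕ} (P : Polynomial Rmin) (c : Fin n → Rmin) : Prop :=
  Monotone c ∧ ∀ y : Rmin, P.eval y = P.coeff n * ∏ i, (y + c i)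

theorem le_sum_iff' {ι : Type*} (s : Finset ι) (f : ι → Rmin) (t : Rmin) :
    t ≤ ∑ i ∈ s, f i ↔ ∀ i ∈ s, t ≤ f i := by
  rw [← Tropical.untrop_le_iff, Finset.untrop_sum', Finset.le_inf_iff]
  rfl

theorem sum_le_term {ι : Type*} (s : Finset ι) (f : ι → Rmin) {i : ι} (hi : i ∈ s) :
    ∑ i ∈ s, f i ≤ f i := (le_sum_iff' s f _).1 le_rfl i hi

theorem exists_ofReal {x : Rmin} (hx : x ≠ 0) : ∃ r : ℝ, x = ofReal r := by
  have h : Tropical.untrop x ≠ ⊤ := fun h => hx (Tropical.untrop_injective h)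
  obtain ⟨r, hr⟩ := WithTop.ne_top_iff_exists.1 h
  exact ⟨r, Tropical.untrop_injective hr.symm⟩

theorem ofReal_ne_zero (r : ℝ) : ofReal r ≠ 0 := by
  intro h
  have := congrArg Tropical.untrop h
  exact WithTop.coe_ne_top this

theorem ofReal_mul (r s : ℝ) : ofReal r * ofReal s = ofReal (r + s) := rfl

theorem ofReal_pow (r : ℝ) (m : ℕ) : ofReal r ^ m = ofReal (m * r) := by
  induction m with
  | zero => simp; rfl
  | succ k ih => rw [pow_succ, ih, ofReal_mul]; congr 1; push_cast; ring

theorem ofReal_le {r s : ℝ} : ofReal r ≤ ofReal s ↔ r ≤ s := by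
  rw [← Tropical.untrop_le_iff]; exact WithTop.coe_le_coe

theorem ofReal_cancel {r : ℝ} {x y : Rmin} (h : ofReal r * x = ofReal r * y) : x = y := by
  have := congrArg (fun z => ofReal (-r) * z) h
  simp only [← mul_assoc, ofReal_mul, neg_add_cancel] at this
  have h1 : ofReal 0 = 1 := rfl
  simpa [h1] using this

theorem le_zero' (x : Rmin) : x ≤ 0 := by
  rw [← Tropical.untrop_le_iff]; exact le_top

theorem exists_factor (n : ℕ) : ∀ p : ℕ → Rmin, p n ≠ 0 → ∃ c : Fin n → Rmin, ∀ y : Rmin,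
    ∑ j ∈ Finset.range (n + 1), p j * y ^ j = p n * ∏ i, (y + c i) := by
  induction n using Nat.strong_induction_on with
  | _ n ih =>
  intro p hn
  by_cases hall : ∀ j < n, p j = 0
  · refine ⟨fun _ => 0, fun y => ?_⟩
    rw [Finset.sum_range_succ, Finset.sum_eq_zero]
    · simp
    · intro j hj; simp [hall j (Finset.mem_range.1 hj)]
  push Not at hall
  obtain ⟨q, hq⟩ := exists_ofReal hn
  let r : ℕ → ℝ := fun j => ((Tropical.untrop (p j)).untopD 0 - q) / (n - j)
  obtain ⟨k, hk, hmin⟩ := Finset.exists_min_image ((Finset.range n).filter (fun j => p j ≠ 0)) r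
    (by obtain ⟨j, hj, hj'⟩ := hall
        exact ⟨j, by simp [hj, hj']⟩)
  simp only [Finset.mem_filter, Finset.mem_range] at hk hmin
  have hval : ∀ j < n, p j ≠ 0 → p j = ofReal (q + (n - j : ℕ) * r j) := by
    intro j hj hj'
    obtain ⟨s, hs⟩ := exists_ofReal hj'
    have h0 : ((n : ℝ) - j) ≠ 0 := by
      have : (j : ℝ) < n := by exact_mod_cast hj
      linarith
    have : r j = (s - q) / (n - j) := by simp only [r, hs]; rfl
    rw [this, hs, Nat.cast_sub hj.le]
    congr 1; field_simp; ring
  set b : Rmin := ofReal (r k) with hb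
  have hpk : p k = p n * b ^ (n - k) := by
    rw [hval k hk.1 hk.2, hq, hb, ofReal_pow, ofReal_mul]
  have hge : ∀ j ≤ n, p n * b ^ (n - j) ≤ p j := by
    intro j hj
    rcases hj.eq_or_lt with rfl | hj
    · simp
    by_cases h0 : p j = 0
    · rw [h0]; exact le_zero' _
    rw [hval j hj h0, hq, hb, ofReal_pow, ofReal_mul, ofReal_le]
    have := hmin j ⟨hj, h0⟩
    gcongr
  obtain ⟨c, hc⟩ := ih k hk.1 p hk.2
  have hkn : k + (n - k) = n := by omega
  refine ⟨fun i => Fin.addCases (m := k) (n := n - k) c (fun _ => b) (Fin.cast hkn.symm i),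
    fun y => ?_⟩
  have hprod : ∏ i : Fin n, (y + Fin.addCases (m := k) (n := n - k) (motive := fun _ => Rmin)
      c (fun _ => b) (Fin.cast hkn.symm i)) = (∏ i, (y + c i)) * (y + b) ^ (n - k) := by
    rw [← Fin.prod_congr' _ hkn, Fin.prod_univ_add]
    simp
  rw [hprod]
  rcases le_total b y with hby | hyb
  · rw [Tropical.add_eq_right hby, mul_comm (∏ i, (y + c i)), ← mul_assoc, ← hpk, ← hc y]
    apply le_antisymm
    · rw [le_sum_iff']
      intro j hj
      refine sum_le_term _ (fun j => p j * y ^ j) ?_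
      simp only [Finset.mem_range] at hj ⊢; omega
    · rw [le_sum_iff']
      intro j hj
      rw [Finset.mem_range] at hj
      by_cases hjk : j ≤ k
      · refine sum_le_term _ (fun j => p j * y ^ j) ?_
        simp only [Finset.mem_range]; omega
      calc _ ≤ p k * y ^ k := sum_le_term _ (fun j => p j * y ^ j) (by simp)
        _ = p n * b ^ (n - j) * (b ^ (j - k) * y ^ k) := by
            rw [hpk, show n - k = (n - j) + (j - k) by omega, pow_add]; ring
        _ ≤ p j * (y ^ (j - k) * y ^ k) := by
            gcongr
            exact hge j (by omega)
        _ = p j * y ^ j := by rw [← pow_add]; congr 2; omega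
  · have key : ∀ m ≤ n, p m = p n * b ^ (n - m) →
        ∑ j ∈ Finset.range (m + 1), p j * y ^ j = p m * y ^ m := by
      intro m hm hpm
      apply le_antisymm (sum_le_term _ (fun j => p j * y ^ j) (by simp))
      rw [le_sum_iff']
      intro j hj
      rw [Finset.mem_range] at hj
      calc p m * y ^ m = p n * b ^ (n - m) * (y ^ (m - j) * y ^ j) := by
            rw [hpm, ← pow_add]; congr 2; omega
        _ ≤ p n * b ^ (n - m) * (b ^ (m - j) * y ^ j) := by gcongr
        _ = p n * b ^ (n - j) * y ^ j := by
            rw [show n - j = (n - m) + (m - j) by omega, pow_add]; ring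
        _ ≤ p j * y ^ j := by
            gcongr
            exact hge j (by omega)
    have h1 : ∏ i, (y + c i) = y ^ k := by
      have h2 := hc y
      rw [key k hk.1.le hpk, hval k hk.1 hk.2] at h2
      exact (ofReal_cancel h2).symm
    rw [key n le_rfl (by simp), Tropical.add_eq_left hyb, h1, ← pow_add, hkn]

/-- Every min-plus polynomial of degree `n` has a sequence of roots. -/
theorem exists_isRootSeq {n : ℕ} (P : Polynomial Rmin) (hP : P.natDegree = n) (h0 : P ≠ 0) :
    ∃ c : Fin n → Rmin, IsRootSeq P c := by
  obtain ⟨c, hc⟩ := exists_factor n P.coeff (by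
    rw [← hP]; exact Polynomial.leadingCoeff_ne_zero.2 h0)
  refine ⟨c ∘ Tuple.sort c, Tuple.monotone_sort c, fun y => ?_⟩
  rw [Polynomial.eval_eq_sum_range, hP, hc y]
  congr 1
  exact (Equiv.prod_comp (Tuple.sort c) (fun i => y + c i)).symm

/-- The sequence of roots of a nonzero min-plus polynomial of degree `n` is unique. -/
theorem IsRootSeq.unique {n : ℕ} {P : Polynomial Rmin} {c d : Fin n → Rmin}
    (hP : P.natDegree = n) (h0 : P ≠ 0) (hc : IsRootSeq P c) (hd : IsRootSeq P d) : c = d := by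
  obtain ⟨q, hq⟩ := exists_ofReal (x := P.coeff n) (by
    rw [← hP]; exact Polynomial.leadingCoeff_ne_zero.2 h0)
  have h : ∀ y : Rmin, ∏ i, (y + c i) = ∏ i, (y + d i) := fun y =>
    ofReal_cancel (r := q) (by rw [← hq, ← hc.2 y, ← hd.2 y])
  have hcm := hc.1
  have hdm := hd.1
  clear hc hd hP hq
  induction n with
  | zero => exact Subsingleton.elim _ _
  | succ m ih =>
    have aux : ∀ c d : Fin (m + 1) → Rmin, Monotone c → Monotone d →
        (∀ y : Rmin, ∏ i, (y + c i) = ∏ i, (y + d i)) → d 0 ≤ c 0 := by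
      intro c d hcm hdm h
      by_contra! hlt
      have h1 := h (d 0)
      have h2 : ∏ i, (d 0 + d i) = d 0 ^ (m + 1) := by
        rw [Finset.prod_congr rfl (fun i _ => Tropical.add_eq_left (hdm (Fin.zero_le i)))]
        simp
      rw [h2, Fin.prod_univ_succ, Tropical.add_eq_right hlt.le] at h1
      have hc0 : c 0 ≠ 0 := fun h => absurd hlt (not_lt.2 (h ▸ le_zero' _))
      obtain ⟨s, hs⟩ := exists_ofReal hc0
      -- evaluate strictly between, or at a real point above `c 0` and at most `d 0`
      obtain ⟨t, hst, htd⟩ : ∃ t : ℝ, s < t ∧ ofReal t ≤ d 0 := by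
        by_cases hd0 : d 0 = 0
        · exact ⟨s + 1, by linarith, hd0 ▸ le_zero' _⟩
        · obtain ⟨t, ht⟩ := exists_ofReal hd0
          refine ⟨t, ?_, ht.ge⟩
          rw [hs, ht] at hlt
          exact lt_of_not_ge fun hh => absurd hlt (not_lt.2 (ofReal_le.2 hh))
      have h3 := h (ofReal t)
      rw [Finset.prod_congr rfl (fun i _ => Tropical.add_eq_left
        (htd.trans (hdm (Fin.zero_le i)))), Fin.prod_univ_succ, hs,
        Tropical.add_eq_right (ofReal_le.2 hst.le)] at h3
      have h4 : ∏ i : Fin m, (ofReal t + c i.succ) ≤ ofReal t ^ m := by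
        calc _ ≤ ∏ _i : Fin m, ofReal t := Finset.prod_le_prod' fun i _ => by
              rw [← Tropical.untrop_le_iff, Tropical.untrop_add]; exact min_le_left _ _
          _ = _ := by simp
      have h5 : ofReal t ^ (m + 1) ≤ ofReal s * ofReal t ^ m := by
        have : ∏ _i : Fin (m + 1), ofReal t = ofReal t ^ (m + 1) := by simp
        rw [← this, ← h3]
        gcongr
      rw [pow_succ', ofReal_pow, ofReal_mul, ofReal_mul, ofReal_le] at h5
      linarith
    have e0 : c 0 = d 0 :=
      le_antisymm (aux d c hdm hcm fun y => (h y).symm) (aux c d hcm hdm h)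
    by_cases hz : c 0 = 0
    · funext i
      rw [le_antisymm (le_zero' (c i)) (hz ▸ hcm (Fin.zero_le i)),
        le_antisymm (le_zero' (d i)) ((e0 ▸ hz) ▸ hdm (Fin.zero_le i))]
    have htail : (fun i : Fin m => c i.succ) = fun i => d i.succ := by
      refine ih (fun y => ?_) (hcm.comp (Fin.strictMono_succ.monotone))
        (hdm.comp (Fin.strictMono_succ.monotone))
      have hy := h y
      rw [Fin.prod_univ_succ, Fin.prod_univ_succ, ← e0] at hy
      obtain ⟨u, hu⟩ := exists_ofReal (x := y + c 0) (fun hh => by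
        rw [Tropical.add_eq_zero_iff] at hh; exact hz hh.2)
      rw [hu] at hy
      exact ofReal_cancel hy
    funext i
    refine Fin.cases e0 (fun j => congrFun htail j) i

theorem coeff_charpoly {n : ℕ} (A : Matrix (Fin n) (Fin n) Rmin) :
    (charpoly A).natDegree ≤ n ∧ (charpoly A).coeff n = 1 := by
  classical
  have hdeg : ∀ i j, ((Matrix.scalar (Fin n) (Polynomial.X : Polynomial Rmin)
      + A.map Polynomial.C) i j).natDegree ≤ 1 := by
    intro i j
    rw [Matrix.add_apply, Matrix.scalar_apply, Matrix.map_apply]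
    refine (Polynomial.natDegree_add_le _ _).trans (max_le ?_ (by simp))
    by_cases hij : i = j
    · subst hij; simp
    · simp [Matrix.diagonal_apply_ne _ hij]
  constructor
  · refine Polynomial.natDegree_sum_le_of_forall_le _ _ fun σ _ => ?_
    refine (Polynomial.natDegree_prod_le _ _).trans ?_
    refine (Finset.sum_le_sum fun i _ => hdeg (σ i) i).trans ?_
    simp
  · rw [charpoly, Matrix.permanent, Polynomial.finsetSum_coeff,
      Finset.sum_eq_single (1 : Equiv.Perm (Fin n))]
    · have := Polynomial.coeff_prod_of_natDegree_le (s := Finset.univ)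
        (fun i : Fin n => (Matrix.scalar (Fin n) (Polynomial.X : Polynomial Rmin)
          + A.map Polynomial.C) i i) 1 (fun i _ => hdeg i i)
      simp only [Finset.card_univ, Fintype.card_fin, mul_one] at this
      simp only [Equiv.Perm.one_apply]
      rw [this]
      refine Finset.prod_eq_one fun i _ => ?_
      simp [Polynomial.coeff_C]
    · intro σ _ hσ
      have := Polynomial.coeff_prod_of_natDegree_le (s := Finset.univ)
        (fun i : Fin n => (Matrix.scalar (Fin n) (Polynomial.X : Polynomial Rmin)
          + A.map Polynomial.C) (σ i) i) 1 (fun i _ => hdeg (σ i) i)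
      simp only [Finset.card_univ, Fintype.card_fin, mul_one] at this
      rw [this]
      obtain ⟨i, hi⟩ : ∃ i, σ i ≠ i := by
        by_contra! hh; exact hσ (Equiv.ext hh)
      refine Finset.prod_eq_zero (Finset.mem_univ i) ?_
      simp [Matrix.diagonal_apply_ne _ hi, Polynomial.coeff_C]
    · simp

theorem charpoly_ne_zero {n : ℕ} (A : Matrix (Fin n) (Fin n) Rmin) : charpoly A ≠ 0 := by
  intro h
  have h1 := (coeff_charpoly A).2
  rw [h, Polynomial.coeff_zero] at h1
  exact ofReal_ne_zero 0 h1.symm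

theorem natDegree_charpoly {n : ℕ} (A : Matrix (Fin n) (Fin n) Rmin) :
    (charpoly A).natDegree = n := by
  refine le_antisymm (coeff_charpoly A).1 (Polynomial.le_natDegree_of_ne_zero ?_)
  rw [(coeff_charpoly A).2]
  exact ofReal_ne_zero 0

/-- The nondecreasing sequence of roots of the min-plus characteristic polynomial of `A`. -/
noncomputable def charpolyRoots {n : ℕ} (A : Matrix (Fin n) (Fin n) Rmin) : Fin n → Rmin :=
  Classical.choose (exists_isRootSeq (charpoly A) (natDegree_charpoly A) (charpoly_ne_zero A))

theorem charpolyRoots_spec {n : ℕ} (A : Matrix (Fin n) (Fin n) Rmin) :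
    IsRootSeq (charpoly A) (charpolyRoots A) :=
  Classical.choose_spec
    (exists_isRootSeq (charpoly A) (natDegree_charpoly A) (charpoly_ne_zero A))

end MinPlus

namespace MinPlus

/-! ### Calculus of first order asymptotics -/

/-! Let `P` be the min-plus characteristic polynomial. For real `y`, the function `det (w ε ^ y I -
𝒜 ε)` is estimated in two ways. Expanding over permutations gives exponent `P(y)`, with a
coefficient that may cancel (`HasEntryAsymp.weakAsymp_det`). Factoring over the eigenvalues gives
exponent `∏ (y ⊕ L i)`, with a nonzero coefficient once `w` avoids `0` and the `l i`
(`HasEigenvalueAsymp.weakAsymp_det`). Hence `P(y) ≤ ∏ (y ⊕ L i)` for every real `y`, and taking `y`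
to be the `k`-th root of `P` yields the majorisation (`weaklyMajorised_of_prod_add_le`). For generic
`a` the first coefficient is a nonzero polynomial in `w`, so some `w` makes both coefficients
nonzero and the exponents agree. The two min-plus polynomial functions then coincide, and uniqueness
of root sequences gives equality. -/

theorem WeakAsymp.congr {f g : ℝ → ℂ} {a : ℂ} {A : Rmin} (hf : WeakAsymp f a A)
    (h : ∀ᶠ ε in 𝓝[>] (0 : ℝ), f ε = g ε) : WeakAsymp g a A := by
  rcases hf with ⟨hA, hf⟩ | ⟨r, hA, hf⟩
  · refine Or.inl ⟨hA, ?_⟩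
    filter_upwards [hf, h] with ε h1 h2
    rw [← h2, h1]
  · refine Or.inr ⟨r, hA, hf.congr' ?_⟩
    filter_upwards [h] with ε h2
    rw [h2]

theorem weakAsymp_zero (a : ℂ) : WeakAsymp (fun _ => 0) a 0 :=
  Or.inl ⟨rfl, Eventually.of_forall fun _ => rfl⟩

theorem weakAsymp_monomial (w : ℂ) (y : ℝ) :
    WeakAsymp (fun ε => w * ((ε ^ y : ℝ) : ℂ)) w (ofReal y) := by
  refine Or.inr ⟨y, rfl, tendsto_const_nhds.congr' ?_⟩
  filter_upwards [self_mem_nhdsWithin] with ε hε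
  have hε : 0 < ε := hε
  have h : ε ^ (-y) * ε ^ y = 1 := by rw [← Real.rpow_add hε]; simp
  rw [mul_left_comm, ← Complex.ofReal_mul, h]
  simp

theorem weakAsymp_const (w : ℂ) : WeakAsymp (fun _ => w) w 1 := by
  refine (weakAsymp_monomial w 0).congr (Eventually.of_forall fun ε => ?_)
  simp

theorem WeakAsymp.mul {f g : ℝ → ℂ} {a b : ℂ} {A B : Rmin} (hf : WeakAsymp f a A)
    (hg : WeakAsymp g b B) : WeakAsymp (fun ε => f ε * g ε) (a * b) (A * B) := by
  rcases hf with ⟨hA, hf⟩ | ⟨r, hA, hf⟩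
  · refine Or.inl ⟨by simp [hA], ?_⟩
    filter_upwards [hf] with ε h
    simp [h]
  rcases hg with ⟨hB, hg⟩ | ⟨s, hB, hg⟩
  · refine Or.inl ⟨by simp [hB], ?_⟩
    filter_upwards [hg] with ε h
    simp [h]
  refine Or.inr ⟨r + s, by rw [hA, hB, ofReal_mul], (hf.mul hg).congr' ?_⟩
  filter_upwards [self_mem_nhdsWithin] with ε hε
  have hε : 0 < ε := hε
  rw [neg_add, Real.rpow_add hε]
  push_cast
  ring

theorem WeakAsymp.neg {f : ℝ → ℂ} {a : ℂ} {A : Rmin} (hf : WeakAsymp f a A) :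
    WeakAsymp (fun ε => -f ε) (-a) A := by
  simpa using (weakAsymp_const (-1)).mul hf

theorem WeakAsymp.prod {ι : Type*} (s : Finset ι) {f : ι → ℝ → ℂ} {a : ι → ℂ} {A : ι → Rmin}
    (h : ∀ i ∈ s, WeakAsymp (f i) (a i) (A i)) :
    WeakAsymp (fun ε => ∏ i ∈ s, f i ε) (∏ i ∈ s, a i) (∏ i ∈ s, A i) := by
  classical
  induction s using Finset.induction_on with
  | empty => simpa using weakAsymp_const 1
  | insert i s hi ih =>
    simp only [Finset.prod_insert hi]
    exact (h i (by simp)).mul (ih fun j hj => h j (by simp [hj]))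

theorem ofReal_inj {r s : ℝ} : ofReal r = ofReal s ↔ r = s := by
  rw [le_antisymm_iff, le_antisymm_iff, ofReal_le, ofReal_le]

open Classical in
-- If the true exponent `r` exceeds `p`, the extra factor `ε ^ (r - p)` tends to `0`. Terms with
-- different exponents can thus be normalised by one common power and added.
theorem WeakAsymp.tendsto_of_le {f : ℝ → ℂ} {a : ℂ} {A : Rmin} (hf : WeakAsymp f a A) {p : ℝ}
    (hp : ofReal p ≤ A) :
    Tendsto (fun ε : ℝ => ((ε ^ (-p) : ℝ) : ℂ) * f ε) (𝓝[>] (0 : ℝ))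
      (𝓝 (if A = ofReal p then a else 0)) := by
  rcases hf with ⟨hA, hf⟩ | ⟨r, hA, hf⟩
  · rw [if_neg (by rw [hA]; exact (ofReal_ne_zero p).symm)]
    refine tendsto_const_nhds.congr' ?_
    filter_upwards [hf] with ε h
    simp [h]
  subst hA
  rw [ofReal_le] at hp
  rcases hp.eq_or_lt with rfl | hp
  · simpa using hf
  rw [if_neg (by rw [ofReal_inj]; exact hp.ne')]
  have h1 : Tendsto (fun ε : ℝ => ε ^ (r - p)) (𝓝[>] (0 : ℝ)) (𝓝 0) := by
    have := (Real.continuousAt_rpow_const 0 (r - p) (Or.inr (by linarith))).tendsto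
    rw [Real.zero_rpow (by linarith)] at this
    exact this.mono_left nhdsWithin_le_nhds
  have h2 := ((Complex.continuous_ofReal.tendsto 0).comp h1).mul hf
  rw [Complex.ofReal_zero, zero_mul] at h2
  refine h2.congr' ?_
  filter_upwards [self_mem_nhdsWithin] with ε hε
  have hε : 0 < ε := hε
  have h3 : ε ^ (-p) = ε ^ (r - p) * ε ^ (-r) := by
    rw [← Real.rpow_add hε]; congr 1; ring
  rw [h3]
  simp [mul_assoc]

open Classical in
/-- The asymptotics of a sum: only the terms of dominant exponent contribute. -/
theorem WeakAsymp.sum {ι : Type*} (s : Finset ι) {f : ι → ℝ → ℂ} {a : ι → ℂ} {A : ι → Rmin}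
    (h : ∀ i ∈ s, WeakAsymp (f i) (a i) (A i)) {p : ℝ} (hp : ∑ i ∈ s, A i = ofReal p) :
    WeakAsymp (fun ε => ∑ i ∈ s, f i ε) (∑ i ∈ s with A i = ofReal p, a i) (ofReal p) := by
  refine Or.inr ⟨p, rfl, ?_⟩
  simp only [Finset.mul_sum, Finset.sum_filter]
  exact tendsto_finsetSum _ fun i hi =>
    (h i hi).tendsto_of_le (hp ▸ sum_le_term s A hi)

/-- If `q < p`, then `ε ^ (-q) f(ε)` would tend both to `0` and to `b`. Nonvanishing is needed on
one side only, so each nonzero coefficient gives one of the two inequalities between exponents. -/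
theorem WeakAsymp.exponent_le {f : ℝ → ℂ} {a b : ℂ} {p q : ℝ} (ha : WeakAsymp f a (ofReal p))
    (hb : WeakAsymp f b (ofReal q)) (hb0 : b ≠ 0) : p ≤ q := by
  classical
  by_contra! h
  have h1 := ha.tendsto_of_le (ofReal_le.2 h.le)
  have h2 := hb.tendsto_of_le le_rfl
  rw [if_neg (by rw [ofReal_inj]; exact h.ne')] at h1
  rw [if_pos rfl] at h2
  exact hb0 (tendsto_nhds_unique h2 h1)

/-- Subtracting first order asymptotics from a monomial whose coefficient is generic. -/
theorem FirstOrderAsymp.monomial_sub {f : ℝ → ℂ} {l : ℂ} {L : Rmin} (hf : FirstOrderAsymp f l L)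
    {w : ℂ} (hw : w ≠ 0) (hwl : w ≠ l) (y : ℝ) :
    ∃ d : ℂ, d ≠ 0 ∧ WeakAsymp (fun ε => w * ((ε ^ y : ℝ) : ℂ) - f ε) d (ofReal y + L) := by
  have hm := weakAsymp_monomial w y
  rcases hf with ⟨rfl, hf⟩ | ⟨r, rfl, hl, hf⟩
  · refine ⟨w, hw, ?_⟩
    rw [add_zero]
    refine hm.congr ?_
    filter_upwards [hf] with ε h
    simp [h]
  have hg : WeakAsymp (fun ε => -f ε) (-l) (ofReal r) := WeakAsymp.neg (Or.inr ⟨r, rfl, hf⟩)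
  classical
  have key : ∀ p : ℝ, ofReal p ≤ ofReal y → ofReal p ≤ ofReal r →
      WeakAsymp (fun ε => w * ((ε ^ y : ℝ) : ℂ) - f ε)
        ((if ofReal y = ofReal p then w else 0) + if ofReal r = ofReal p then -l else 0)
        (ofReal p) := by
    intro p h1 h2
    refine Or.inr ⟨p, rfl, ((hm.tendsto_of_le h1).add (hg.tendsto_of_le h2)).congr fun ε => ?_⟩
    ring
  -- The smaller exponent dominates; only a tie can cancel, and `w ≠ l` excludes that.
  rcases lt_trichotomy y r with h | rfl | h
  · refine ⟨w, hw, ?_⟩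
    rw [Tropical.add_eq_left (ofReal_le.2 h.le)]
    simpa [ofReal_inj, h.ne'] using key y le_rfl (ofReal_le.2 h.le)
  · refine ⟨w - l, sub_ne_zero.2 hwl, ?_⟩
    rw [Tropical.add_eq_left le_rfl]
    simpa [sub_eq_add_neg] using key y le_rfl le_rfl
  · refine ⟨-l, neg_ne_zero.2 hl, ?_⟩
    rw [Tropical.add_eq_right (ofReal_le.2 h.le)]
    simpa [ofReal_inj, h.ne'] using key r (ofReal_le.2 h.le) le_rfl

/-! ### Expansion of permanents and determinants -/

/-- The term of the expansion of `per (z I + M)` given by a permutation and the set of indices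
at which the diagonal entry `z` is selected. -/
def expansionTerm {n : ℕ} {R : Type*} [CommSemiring R] (x : Equiv.Perm (Fin n) × Finset (Fin n))
    (z : R) (M : Matrix (Fin n) (Fin n) R) : R :=
  (∏ i ∈ x.2, if x.1 i = i then z else 0) * ∏ i ∈ x.2ᶜ, M (x.1 i) i

/-- Indexing by all subsets lets permanent and determinant share one index set. A subset containing
a non-fixed point contributes the zero of `R`, which is `+∞` in `Rmin`. -/
theorem prod_scalar_add {n : ℕ} {R : Type*} [CommSemiring R] (z : R)
    (M : Matrix (Fin n) (Fin n) R) (σ : Equiv.Perm (Fin n)) :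
    ∏ i, (Matrix.scalar (Fin n) z + M) (σ i) i = ∑ S, expansionTerm (σ, S) z M := by
  simp only [Matrix.add_apply, Matrix.scalar_apply, Matrix.diagonal_apply, Finset.prod_add,
    Finset.powerset_univ, expansionTerm, Finset.compl_eq_univ_sdiff]

theorem permanent_scalar_add {n : ℕ} {R : Type*} [CommSemiring R] (z : R)
    (M : Matrix (Fin n) (Fin n) R) :
    (Matrix.scalar (Fin n) z + M).permanent = ∑ x, expansionTerm x z M := by
  rw [Matrix.permanent, Fintype.sum_prod_type]
  exact Finset.sum_congr rfl fun σ _ => prod_scalar_add z M σ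

theorem det_scalar_add {n : ℕ} {R : Type*} [CommRing R] (z : R)
    (M : Matrix (Fin n) (Fin n) R) :
    (Matrix.scalar (Fin n) z + M).det =
      ∑ x : Equiv.Perm (Fin n) × Finset (Fin n),
        ((Equiv.Perm.sign x.1 : ℤ) : R) * expansionTerm x z M := by
  rw [Matrix.det_apply', Fintype.sum_prod_type]
  refine Finset.sum_congr rfl fun σ _ => ?_
  rw [prod_scalar_add, Finset.mul_sum]

theorem eval_charpoly {n : ℕ} (A : Matrix (Fin n) (Fin n) Rmin) (y : Rmin) :
    (charpoly A).eval y = ∑ x, expansionTerm x y A := by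
  rw [← permanent_scalar_add, charpoly, Matrix.permanent, Matrix.permanent,
    Polynomial.eval_finsetSum]
  refine Finset.sum_congr rfl fun σ _ => ?_
  rw [Polynomial.eval_prod]
  refine Finset.prod_congr rfl fun i _ => ?_
  by_cases h : σ i = i <;> simp [h]

theorem prod_add_eq_eval_charpoly {n : ℕ} (A : Matrix (Fin n) (Fin n) Rmin) (y : Rmin) :
    ∏ i, (y + charpolyRoots A i) = (charpoly A).eval y := by
  rw [(charpolyRoots_spec A).2 y, (coeff_charpoly A).2, one_mul]

/-- Each factor is a minimum with the real number `y`, hence finite. -/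
theorem exists_prod_add_eq_ofReal {n : ℕ} (u : Fin n → Rmin) (s : Finset (Fin n)) (y : ℝ) :
    ∃ p : ℝ, ∏ i ∈ s, (ofReal y + u i) = ofReal p := by
  refine exists_ofReal (Finset.prod_ne_zero_iff.2 fun i _ h => ?_)
  exact ofReal_ne_zero y (Tropical.add_eq_zero_iff.1 h).1

/-- The coefficient of `ε ^ P(y)` in `det (w ε ^ y I - 𝒜)`, where `P` is the min-plus
characteristic polynomial, is a sum over this set of dominant terms. -/
noncomputable def dominantTerms {n : ℕ} (A : Matrix (Fin n) (Fin n) Rmin) (y : Rmin) :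
    Finset (Equiv.Perm (Fin n) × Finset (Fin n)) := by
  classical exact Finset.univ.filter fun x => expansionTerm x y A = (charpoly A).eval y

/-- Each term of the determinant has as its exponent the corresponding term of the min-plus
permanent, and the minimum of these is `P(y)`. -/
theorem HasEntryAsymp.weakAsymp_det {n : ℕ} {𝒜 : ℝ → Matrix (Fin n) (Fin n) ℂ}
    {a : Matrix (Fin n) (Fin n) ℂ} {A : Matrix (Fin n) (Fin n) Rmin} (h : HasEntryAsymp 𝒜 a A)
    (w : ℂ) (y : ℝ) :
    WeakAsymp (fun ε => (Matrix.scalar (Fin n) (w * ((ε ^ y : ℝ) : ℂ)) + -𝒜 ε).det)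
      (∑ x ∈ dominantTerms A (ofReal y),
        ((Equiv.Perm.sign x.1 : ℤ) : ℂ) * expansionTerm x w (-a))
      ((charpoly A).eval (ofReal y)) := by
  classical
  obtain ⟨p, hp⟩ := exists_prod_add_eq_ofReal (charpolyRoots A) Finset.univ y
  rw [prod_add_eq_eval_charpoly] at hp
  simp only [det_scalar_add, dominantTerms, hp]
  refine WeakAsymp.sum Finset.univ (fun x _ => ?_) (by rw [← eval_charpoly, hp])
  -- The unit factor is the exponent carried by the constant sign.
  rw [← one_mul (expansionTerm x (ofReal y) A)]
  refine (weakAsymp_const _).mul ((WeakAsymp.prod _ fun i _ => ?_).mul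
    (WeakAsymp.prod _ fun i _ => ((h _ _).2).neg))
  by_cases hi : x.1 i = i
  · simpa [hi] using weakAsymp_monomial w y
  · simpa [hi] using weakAsymp_zero 0

theorem HasEigenvalueAsymp.weakAsymp_det {n : ℕ} {𝒜 : ℝ → Matrix (Fin n) (Fin n) ℂ}
    {𝓛 : Fin n → ℝ → ℂ} {l : Fin n → ℂ} {L : Fin n → Rmin} (h : HasEigenvalueAsymp 𝒜 𝓛 l L)
    {w : ℂ} (hw : w ≠ 0) (hwl : ∀ i, w ≠ l i) (y : ℝ) :
    ∃ d : ℂ, d ≠ 0 ∧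
      WeakAsymp (fun ε => (Matrix.scalar (Fin n) (w * ((ε ^ y : ℝ) : ℂ)) + -𝒜 ε).det) d
        (∏ i, (ofReal y + L i)) := by
  choose d hd hasymp using fun i => (h.2 i).2.monomial_sub hw (hwl i) y
  refine ⟨∏ i, d i, Finset.prod_ne_zero_iff.2 fun i _ => hd i,
    (WeakAsymp.prod Finset.univ fun i _ => hasymp i).congr ?_⟩
  filter_upwards [h.1] with ε hε
  have hsplit := (IsAlgClosed.splits (𝒜 ε).charpoly).eq_prod_roots_of_monic
    (Matrix.charpoly_monic _)
  rw [← sub_eq_add_neg, ← Matrix.eval_charpoly, hsplit, hε, Multiset.map_map,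
    Polynomial.eval_multiset_prod, Multiset.map_map]
  simp only [Function.comp_apply, Polynomial.eval_sub, Polynomial.eval_X, Polynomial.eval_C]
  rfl

theorem prod_add_charpolyRoots_le {n : ℕ} {A : Matrix (Fin n) (Fin n) Rmin}
    {a : Matrix (Fin n) (Fin n) ℂ} {𝒜 : ℝ → Matrix (Fin n) (Fin n) ℂ}
    {𝓛 : Fin n → ℝ → ℂ} {l : Fin n → ℂ} {L : Fin n → Rmin}
    (h𝒜 : HasEntryAsymp 𝒜 a A) (h𝓛 : HasEigenvalueAsymp 𝒜 𝓛 l L) (y : ℝ) :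
    ∏ i, (ofReal y + charpolyRoots A i) ≤ ∏ i, (ofReal y + L i) := by
  classical
  -- Only finitely many values of `w` can cancel a leading term of some `w ε ^ y - 𝓛 i ε`.
  obtain ⟨w, hw⟩ := Infinite.exists_notMem_finset (insert 0 (Finset.univ.image l))
  simp only [Finset.mem_insert, Finset.mem_image, Finset.mem_univ, true_and, not_or,
    not_exists] at hw
  obtain ⟨d, hd, hdet⟩ := h𝓛.weakAsymp_det hw.1 (fun i hi => hw.2 i hi.symm) y
  have hdet' := h𝒜.weakAsymp_det w y
  rw [← prod_add_eq_eval_charpoly] at hdet'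
  obtain ⟨p, hp⟩ := exists_prod_add_eq_ofReal (charpolyRoots A) Finset.univ y
  obtain ⟨q, hq⟩ := exists_prod_add_eq_ofReal L Finset.univ y
  rw [hp] at hdet' ⊢
  rw [hq] at hdet ⊢
  exact ofReal_le.2 (hdet'.exponent_le hdet hd)

/-! ### Majorisation from comparison of min-plus polynomial functions -/

theorem prod_add_increasing {n : ℕ} (u : Fin n → Rmin) (y : Rmin) :
    ∏ i, (y + increasing u i) = ∏ i, (y + u i) :=
  Equiv.prod_comp (Tuple.sort u) (fun i => y + u i)

theorem ofReal_mul_le_cancel {r : ℝ} {x y : Rmin} (h : ofReal r * x ≤ ofReal r * y) : x ≤ y := by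
  have h2 : ofReal (-r) * (ofReal r * x) ≤ ofReal (-r) * (ofReal r * y) := by gcongr
  have h1 : ofReal 0 = 1 := rfl
  simpa only [← mul_assoc, ofReal_mul, neg_add_cancel, h1, one_mul] using h2

theorem prod_add_const_eq {n : ℕ} (s : Finset (Fin n)) (y : ℝ) :
    ∃ p : ℝ, ∏ _i ∈ s, ofReal y = ofReal p :=
  exists_ofReal (Finset.prod_ne_zero_iff.2 fun _ _ => ofReal_ne_zero y)

theorem prod_Iic_mul_prod_Ioi {n : ℕ} (f : Fin n → Rmin) (k : Fin n) :
    ∏ i, f i = (∏ i ∈ Finset.Ioi k, f i) * ∏ i ∈ Finset.Iic k, f i := by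
  rw [← Finset.prod_union]
  · congr 1
    ext i
    simp [lt_or_ge]
  · rw [Finset.disjoint_left]
    intro i hi hi'
    simp only [Finset.mem_Ioi, Finset.mem_Iic] at hi hi'
    exact absurd hi (not_lt.2 hi')

/-- At a real `y ≤ V k`, every factor beyond `k` on the `v` side equals `y`. On the `u` side, bound
those factors by `y` and the others by `U i`, then cancel the powers of `y`. The choice `y = V k`
concludes when `V k` is finite; otherwise `y` is taken large. -/
theorem weaklyMajorised_of_prod_add_le {n : ℕ} {u v : Fin n → Rmin}
    (h : ∀ y : ℝ, ∏ i, (ofReal y + v i) ≤ ∏ i, (ofReal y + u i)) : WeaklyMajorised u v := by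
  intro k
  have hv : Monotone (increasing v) := Tuple.monotone_sort v
  set U := increasing u with hU
  set V := increasing v with hV
  have key : ∀ y : ℝ, ofReal y ≤ V k →
      ∏ i ∈ Finset.Iic k, (ofReal y + V i) ≤ ∏ i ∈ Finset.Iic k, U i := by
    intro y hy
    have h1 := h y
    rw [← prod_add_increasing, ← prod_add_increasing u, prod_Iic_mul_prod_Ioi _ k,
      prod_Iic_mul_prod_Ioi (fun i => ofReal y + increasing u i) k] at h1
    have h2 : ∏ i ∈ Finset.Ioi k, (ofReal y + V i) = ∏ _i ∈ Finset.Ioi k, ofReal y :=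
      Finset.prod_congr rfl fun i hi =>
        Tropical.add_eq_left (hy.trans (hv (Finset.mem_Ioi.1 hi).le))
    obtain ⟨p, hp⟩ := prod_add_const_eq (Finset.Ioi k) y
    rw [← hV, ← hU, h2, hp] at h1
    refine ofReal_mul_le_cancel (h1.trans ?_)
    rw [← hp]
    refine mul_le_mul' (Finset.prod_le_prod' fun i _ => ?_)
      (Finset.prod_le_prod' fun i _ => ?_)
    · exact Tropical.untrop_le_iff.1 (min_le_left _ _)
    · exact Tropical.untrop_le_iff.1 (min_le_right _ _)
  by_cases hk : V k = 0
  · by_contra! hlt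
    obtain ⟨s, hs⟩ := exists_ofReal (x := ∏ i ∈ Finset.Iic k, U i)
      fun h0 => absurd hlt (not_lt.2 (h0 ▸ le_zero' _))
    obtain ⟨p, hp⟩ := exists_prod_add_eq_ofReal V (Finset.Iio k) 0
    have hIic : ∀ f : Fin n → Rmin,
        ∏ i ∈ Finset.Iic k, f i = f k * ∏ i ∈ Finset.Iio k, f i := by
      intro f
      rw [← Finset.Iio_insert, Finset.prod_insert (by simp)]
    -- The factor `y ⊕ V k` is `y` itself, and the factors before `k` multiply to at least their
    -- value `p` at `y = 0` as soon as `y ≥ 0`. So `y + p ≤ s`, which fails at this `y`.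
    have hy : 0 ≤ max 0 (s - p + 1) := le_max_left _ _
    have h1 := key (max 0 (s - p + 1)) (hk ▸ le_zero' _)
    rw [hIic, hk, add_zero, hs] at h1
    have h2 : ofReal p ≤ ∏ i ∈ Finset.Iio k, (ofReal (max 0 (s - p + 1)) + V i) := by
      rw [← hp]
      refine Finset.prod_le_prod' fun i _ => ?_
      gcongr
      exact ofReal_le.2 hy
    have h3 := (mul_le_mul_right h2 (ofReal (max 0 (s - p + 1)))).trans h1
    rw [ofReal_mul, ofReal_le] at h3
    linarith [le_max_right 0 (s - p + 1)]
  · obtain ⟨r, hr⟩ := exists_ofReal hk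
    have h1 := key r hr.ge
    rwa [Finset.prod_congr rfl fun i hi =>
      Tropical.add_eq_right (hr ▸ hv (Finset.mem_Iic.1 hi))] at h1

theorem increasing_eq_charpolyRoots {n : ℕ} {A : Matrix (Fin n) (Fin n) Rmin} {L : Fin n → Rmin}
    (h : ∀ y : ℝ, ∏ i, (ofReal y + L i) = ∏ i, (ofReal y + charpolyRoots A i)) :
    increasing L = charpolyRoots A := by
  rcases n with _ | n
  · exact Subsingleton.elim _ _
  refine IsRootSeq.unique (natDegree_charpoly A) (charpoly_ne_zero A)
    ⟨Tuple.monotone_sort L, fun y => ?_⟩ (charpolyRoots_spec A)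
  rw [(coeff_charpoly A).2, one_mul, ← prod_add_eq_eval_charpoly, prod_add_increasing]
  -- The hypothesis covers real `y` only. At `y = +∞` the claim equates the full products, which is
  -- majorisation in both directions at the last index.
  by_cases hy : y = 0
  · have h1 := weaklyMajorised_of_prod_add_le (fun y => (h y).le) (Fin.last n)
    have h2 := weaklyMajorised_of_prod_add_le (fun y => (h y).ge) (Fin.last n)
    have h3 : Finset.Iic (Fin.last n) = Finset.univ := by
      ext i; simp [Fin.le_last]
    have h4 : ∀ u : Fin (n + 1) → Rmin, ∏ i, increasing u i = ∏ i, u i := fun u => by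
      simpa using prod_add_increasing u 0
    rw [h3, h4, h4] at h1 h2
    simpa [hy] using le_antisymm h2 h1
  · obtain ⟨r, rfl⟩ := exists_ofReal hy
    exact (h r).symm

/-! ### The genericity condition -/

/-- The coefficient of `w ^ m` in the sum of the terms of `det (w I - a)` indexed by `T`. -/
noncomputable def genericCoeff {n : ℕ} (T : Finset (Equiv.Perm (Fin n) × Finset (Fin n))) (m : ℕ) :
    MvPolynomial (Fin n × Fin n) ℂ :=
  ∑ x ∈ T with x.2.card = m,
    ((Equiv.Perm.sign x.1 : ℤ) : MvPolynomial (Fin n × Fin n) ℂ) *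
      ∏ i ∈ x.2ᶜ, -MvPolynomial.X (x.1 i, i)

/-- The pairs of a permutation and a set of fixed points of it. -/
def fixedPairs (n : ℕ) : Finset (Equiv.Perm (Fin n) × Finset (Fin n)) :=
  Finset.univ.filter fun x => ∀ i ∈ x.2, x.1 i = i

/-- Evaluate at the 0/1 matrix supported on the positions used by `x₀`. Only the term of `x₀`
survives, with value `±1`, so distinct pairs do not cancel. -/
theorem genericCoeff_ne_zero {n : ℕ} {T : Finset (Equiv.Perm (Fin n) × Finset (Fin n))}
    (hT : T ⊆ fixedPairs n) {x₀ : Equiv.Perm (Fin n) × Finset (Fin n)} (hx₀ : x₀ ∈ T) :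
    genericCoeff T x₀.2.card ≠ 0 := by
  intro h
  have h1 := congrArg (MvPolynomial.eval
    fun ij : Fin n × Fin n => if ij.2 ∉ x₀.2 ∧ x₀.1 ij.2 = ij.1 then (1 : ℂ) else 0) h
  have hfix : ∀ x ∈ T, ∀ i ∈ x.2, x.1 i = i := fun x hx => (Finset.mem_filter.1 (hT hx)).2
  rw [genericCoeff, map_sum, Finset.sum_eq_single x₀, map_zero] at h1
  · have h2 : ∀ i ∈ x₀.2ᶜ, (-if i ∉ x₀.2 ∧ True then (1 : ℂ) else 0) = -1 := by
      intro i hi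
      simp [Finset.mem_compl.1 hi]
    simp only [map_mul, map_prod, map_neg, MvPolynomial.eval_X, map_intCast] at h1
    rw [Finset.prod_congr rfl h2] at h1
    simp at h1
  · intro x hx hne
    obtain ⟨hxT, hcard⟩ := Finset.mem_filter.1 hx
    by_contra h0
    have h2 : ∀ i ∈ x.2ᶜ, i ∉ x₀.2 ∧ x₀.1 i = x.1 i := by
      intro i hi
      by_contra hi0
      refine h0 ?_
      rw [map_mul, map_prod, Finset.prod_eq_zero hi, mul_zero]
      simp only [map_neg, MvPolynomial.eval_X, if_neg hi0, neg_zero]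
    -- A surviving term avoids `x₀.2` off `x.2`, so `x₀.2 ⊆ x.2`; the cardinalities agree. Both
    -- permutations fix this set and coincide off it.
    have h3 : x₀.2 = x.2 := by
      refine Finset.eq_of_subset_of_card_le (fun i hi => ?_) hcard.le
      by_contra hi'
      exact (h2 i (Finset.mem_compl.2 hi')).1 hi
    refine hne (Prod.ext (Equiv.ext fun i => ?_) h3.symm)
    by_cases hi : i ∈ x.2
    · rw [hfix x hxT i hi, hfix x₀ hx₀ i (h3 ▸ hi)]
    · exact (h2 i (Finset.mem_compl.2 hi)).2.symm
  · intro h2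
    exact absurd (Finset.mem_filter.2 ⟨hx₀, rfl⟩ : x₀ ∈ T.filter fun x => x.2.card = x₀.2.card) h2

/-- A polynomial whose zero set contains all the nongeneric matrices. -/
noncomputable def genericPoly (n : ℕ) : MvPolynomial (Fin n × Fin n) ℂ :=
  ∏ T ∈ (fixedPairs n).powerset, ∏ x ∈ T, genericCoeff T x.2.card

/-- The dominant set varies with `y`, but there are finitely many candidate sets `T`. Multiplying
over all of them gives one polynomial valid for every `y`. -/
theorem genericPoly_ne_zero (n : ℕ) : genericPoly n ≠ 0 :=
  Finset.prod_ne_zero_iff.2 fun _ hT => Finset.prod_ne_zero_iff.2 fun _ hx =>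
    genericCoeff_ne_zero (Finset.mem_powerset.1 hT) hx

/-- A pair with a non-fixed index has exponent `+∞`, whereas `P(y)` is real. -/
theorem dominantTerms_subset {n : ℕ} (A : Matrix (Fin n) (Fin n) Rmin) (y : ℝ) :
    dominantTerms A (ofReal y) ⊆ fixedPairs n := by
  intro x hx
  rw [dominantTerms, Finset.mem_filter] at hx
  refine Finset.mem_filter.2 ⟨Finset.mem_univ _, fun i hi => ?_⟩
  by_contra hne
  obtain ⟨p, hp⟩ := exists_prod_add_eq_ofReal (charpolyRoots A) Finset.univ y
  rw [prod_add_eq_eval_charpoly] at hp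
  refine ofReal_ne_zero p ?_
  rw [← hp, ← hx.2, expansionTerm, Finset.prod_eq_zero hi (if_neg hne), zero_mul]

theorem dominantTerms_nonempty {n : ℕ} (A : Matrix (Fin n) (Fin n) Rmin) (y : ℝ) :
    (dominantTerms A (ofReal y)).Nonempty := by
  obtain ⟨x, -, hx⟩ := Finset.exists_min_image Finset.univ
    (fun x => expansionTerm x (ofReal y) A) Finset.univ_nonempty
  refine ⟨x, ?_⟩
  rw [dominantTerms, Finset.mem_filter, eval_charpoly]
  exact ⟨Finset.mem_univ _, le_antisymm ((le_sum_iff' _ _ _).2 hx)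
    (sum_le_term _ (fun x => expansionTerm x (ofReal y) A) (Finset.mem_univ x))⟩

/-- For generic `a`, the dominant coefficient vanishes for finitely many `w` only. -/
theorem exists_finset_dominant_ne_zero {n : ℕ} {a : Matrix (Fin n) (Fin n) ℂ}
    (ha : MvPolynomial.eval (fun ij => a ij.1 ij.2) (genericPoly n) ≠ 0)
    {T : Finset (Equiv.Perm (Fin n) × Finset (Fin n))} (hT : T ⊆ fixedPairs n)
    (hT0 : T.Nonempty) :
    ∃ F : Finset ℂ, ∀ w ∉ F,
      ∑ x ∈ T, ((Equiv.Perm.sign x.1 : ℤ) : ℂ) * expansionTerm x w (-a) ≠ 0 := by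
  obtain ⟨x₀, hx₀⟩ := hT0
  have h1 : MvPolynomial.eval (fun ij => a ij.1 ij.2) (genericCoeff T x₀.2.card) ≠ 0 := by
    rw [genericPoly, map_prod] at ha
    have h2 := Finset.prod_ne_zero_iff.1 ha T (Finset.mem_powerset.2 hT)
    rw [map_prod] at h2
    exact Finset.prod_ne_zero_iff.1 h2 x₀ hx₀
  -- This is the dominant coefficient as a polynomial in `w`; its coefficient in degree `x₀.2.card`
  -- is the value at `a` of a factor of `genericPoly`.
  let D : Polynomial ℂ := ∑ x ∈ T,
    Polynomial.C (((Equiv.Perm.sign x.1 : ℤ) : ℂ) * ∏ i ∈ x.2ᶜ, -a (x.1 i) i) *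
      Polynomial.X ^ x.2.card
  have hD : D ≠ 0 := by
    intro h0
    refine h1 ?_
    have h2 := congrArg (fun p => Polynomial.coeff p x₀.2.card) h0
    simp only [D, Polynomial.finsetSum_coeff, Polynomial.coeff_C_mul, Polynomial.coeff_X_pow,
      Polynomial.coeff_zero, mul_ite, mul_one, mul_zero] at h2
    rw [genericCoeff, map_sum, Finset.sum_filter]
    refine Eq.trans ?_ h2
    refine Finset.sum_congr rfl fun x _ => ?_
    simp [eq_comm]
  refine ⟨D.roots.toFinset, fun w hw h0 => hw ?_⟩
  rw [Multiset.mem_toFinset, Polynomial.mem_roots hD, Polynomial.IsRoot, ← h0,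
    Polynomial.eval_finsetSum]
  refine Finset.sum_congr rfl fun x hx => ?_
  have hfix : ∀ i ∈ x.2, (if x.1 i = i then w else 0) = w := fun i hi =>
    if_pos ((Finset.mem_filter.1 (hT hx)).2 i hi)
  rw [expansionTerm, Finset.prod_congr rfl hfix, Finset.prod_const]
  simp only [Polynomial.eval_mul, Polynomial.eval_C, Polynomial.eval_pow, Polynomial.eval_X,
    Matrix.neg_apply]
  ring

/-- With `w` also outside the finite set `F`, the entrywise coefficient is nonzero, and the
comparison of exponents runs the other way. -/
theorem le_prod_add_charpolyRoots {n : ℕ} {A : Matrix (Fin n) (Fin n) Rmin}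
    {a : Matrix (Fin n) (Fin n) ℂ}
    (ha : MvPolynomial.eval (fun ij => a ij.1 ij.2) (genericPoly n) ≠ 0)
    {𝒜 : ℝ → Matrix (Fin n) (Fin n) ℂ}
    {𝓛 : Fin n → ℝ → ℂ} {l : Fin n → ℂ} {L : Fin n → Rmin}
    (h𝒜 : HasEntryAsymp 𝒜 a A) (h𝓛 : HasEigenvalueAsymp 𝒜 𝓛 l L) (y : ℝ) :
    ∏ i, (ofReal y + L i) ≤ ∏ i, (ofReal y + charpolyRoots A i) := by
  classical
  obtain ⟨F, hF⟩ := exists_finset_dominant_ne_zero ha (dominantTerms_subset A y)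
    (dominantTerms_nonempty A y)
  obtain ⟨w, hw⟩ := Infinite.exists_notMem_finset (F ∪ insert 0 (Finset.univ.image l))
  simp only [Finset.mem_union, Finset.mem_insert, Finset.mem_image, Finset.mem_univ, true_and,
    not_or, not_exists] at hw
  obtain ⟨d, -, hdet⟩ := h𝓛.weakAsymp_det hw.2.1 (fun i hi => hw.2.2 i hi.symm) y
  have hdet' := h𝒜.weakAsymp_det w y
  rw [← prod_add_eq_eval_charpoly] at hdet'
  obtain ⟨p, hp⟩ := exists_prod_add_eq_ofReal (charpolyRoots A) Finset.univ y
  obtain ⟨q, hq⟩ := exists_prod_add_eq_ofReal L Finset.univ y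
  rw [hp] at hdet' ⊢
  rw [hq] at hdet ⊢
  exact ofReal_le.2 (hdet.exponent_le hdet' (hF w hw.1))

end MinPlus

theorem mainTheorem2 {n : ℕ} (A : Matrix (Fin n) (Fin n) MinPlus.Rmin)
    (hA : MinPlus.IsIrreducible A) :
    (∀ (a : Matrix (Fin n) (Fin n) ℂ) (𝒜 : ℝ → Matrix (Fin n) (Fin n) ℂ)
        (𝓛 : Fin n → ℝ → ℂ) (l : Fin n → ℂ) (L : Fin n → MinPlus.Rmin),
      MinPlus.HasEntryAsymp 𝒜 a A → MinPlus.HasEigenvalueAsymp 𝒜 𝓛 l L →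
      MinPlus.WeaklyMajorised L (MinPlus.charpolyRoots A)) ∧
    MinPlus.HoldsGenerically (fun a : Matrix (Fin n) (Fin n) ℂ =>
      ∀ (𝒜 : ℝ → Matrix (Fin n) (Fin n) ℂ)
        (𝓛 : Fin n → ℝ → ℂ) (l : Fin n → ℂ) (L : Fin n → MinPlus.Rmin),
      MinPlus.HasEntryAsymp 𝒜 a A → MinPlus.HasEigenvalueAsymp 𝒜 𝓛 l L →
      MinPlus.increasing L = MinPlus.charpolyRoots A) := by
  refine ⟨fun a 𝒜 𝓛 l L h𝒜 h𝓛 => MinPlus.weaklyMajorised_of_prod_add_le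
    (MinPlus.prod_add_charpolyRoots_le h𝒜 h𝓛), MinPlus.genericPoly n,
    MinPlus.genericPoly_ne_zero n, fun a hp => ?_⟩
  by_contra ha
  exact hp fun 𝒜 𝓛 l L h𝒜 h𝓛 => MinPlus.increasing_eq_charpolyRoots fun y =>
    le_antisymm (MinPlus.le_prod_add_charpolyRoots ha h𝒜 h𝓛 y)
      (MinPlus.prod_add_charpolyRoots_le h𝒜 h𝓛 y)
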